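/- Write $\mathbb N$ for the set of positive integers and, for an infinite cardinal $\kappa$, put $\log\kappa=\min\{\tau\ge\omega:\kappa\le 2^\tau\}$. Let $G$ be an abelian group. For $X\subseteq G$ and $n\in\mathbb N$ let $nX=\{nx:x\in X\}$, and let $t(G)=\{g\in G: ng=0 \text{ for some } n\in\mathbb N\}$ be the torsion part of $G$. Call a subset $S\subseteq G$ potentially dense in $G$ if $S$ is dense in $(G,\mathscr T)$ for some Hausdorff group topology $\mathscr T$ on $G$. A topological group is precompact if it is topologically isomorphic to a subgroup of some compact Hausdorff group. Suppose that $G$ satisfies at least one of the following conditions: (a) $G$ is divisible, that is, $nG=G$ for every $n\in\mathbb N$; (b) $|t(G)|<|G|$; (c) $|t(G)|\le\omega$; (d) $G$ is almost torsion-free, that is, for every prime $p$ the $p$-rank $r_p(G)=\dim_{\mathbb Z/p\mathbb Z}\{g\in G:pg=0\}$ is finite. Then for every uncountable subset $S$ of $G$ the following conditions are equivalent: (i) $S$ is potentially dense in $G$; (ii) $S$ is $\mathscr T$-dense in $G$ for some precompact Hausdorff group topology $\mathscr T$ on $G$; (iii) $\log\log|nG|\le|nS|$ for every $n\in\mathbb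 N$; (iv) $\log\log|G|\le\min\{|nS|:n\in\mathbb N\}$. -/

import Mathlib

open Cardinal

universe u

/-- `cardLog κ = log κ = min {τ ≥ ω : κ ≤ 2 ^ τ}`, for an infinite cardinal `κ`. -/
noncomputable def cardLog (κ : Cardinal.{u}) : Cardinal.{u} :=
  sInf {τ | ℵ₀ ≤ τ ∧ κ ≤ 2 ^ τ}

/-- The set `nX = {nx : x ∈ X}`. -/
def multSet {G : Type u} [AddGroup G] (n : ℕ) (X : Set G) : Set G :=
  (fun x => n • x) '' X

/-- `G` is divisible: `nG = G` for every `n ≥ 1`. -/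
def IsDivisibleGroup (G : Type u) [AddCommGroup G] : Prop :=
  ∀ n : ℕ, 1 ≤ n → multSet n (Set.univ : Set G) = Set.univ

/-- The `p`-rank `r_p(G)`: the dimension of `{g ∈ G : pg = 0}` over the field `ℤ/pℤ`. -/
noncomputable def pRank (p : ℕ) (G : Type u) [AddCommGroup G] : Cardinal.{u} :=
  letI : Module (ZMod p) (AddSubgroup.torsionBy G (p : ℤ)) :=
    AddSubgroup.torsionBy.zmodModule
  Module.rank (ZMod p) (AddSubgroup.torsionBy G (p : ℤ))

/-- `G` is almost torsion-free: `r_p(G)` is finite for every prime `p`. -/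
def IsAlmostTorsionFree (G : Type u) [AddCommGroup G] : Prop :=
  ∀ p : ℕ, p.Prime → pRank p G < ℵ₀

/-- `S` is potentially dense in `G`: it is dense in some Hausdorff group topology on `G`. -/
def IsPotentiallyDense {G : Type u} [AddGroup G] (S : Set G) : Prop :=
  ∃ _ : TopologicalSpace G, IsTopologicalAddGroup G ∧ T2Space G ∧ Dense S

/-- A topological group is precompact if it is (topologically) isomorphic to a subgroup of some
compact Hausdorff group, which need not be commutative. -/
def IsPrecompactGroup (G : Type u) [AddGroup G] [TopologicalSpace G] : Prop :=
  IsTopologicalAddGroup G ∧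
    ∃ (K : Type u) (_ : AddGroup K) (_ : TopologicalSpace K),
      IsTopologicalAddGroup K ∧ CompactSpace K ∧ T2Space K ∧
        ∃ H : AddSubgroup K, Nonempty (G ≃ₜ+ H)

/-!
If `S` is dense in a Hausdorff group topology, then `n • S` is dense in `nG`, and a Hausdorff space
with a dense subset of size `κ` has at most `2 ^ 2 ^ κ` points. Under each of the four hypotheses
`nG` is as large as the uncountable group `G`, since the `n`-torsion is smaller than `G`; this
relates the conditions on `nG` and on `G`.

The substance is the construction of a precompact topology from the inequalities `κ ≤ #(n • S)`,
where `κ = log log #G`, so that `#G ≤ 2 ^ 2 ^ κ`. No further hypothesis on `G` is needed for it: `G`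
is embedded into a power of the circle with the image of `S` dense
(`exists_injective_hom_pi_dense_image`). There are three steps.

* *Interpolation points.* A transfinite sequence of length `κ` in `S` is chosen such that characters
  can take arbitrary values, up to given tolerances, at all of its points
  (`exists_interpolation_points`). If `κ` is uncountable, some multiple of an element of `S` avoids
  any given subgroup with fewer than `κ` elements, so the next point has large order modulo the
  previous ones (`exists_mem_characters_vanishing_of_mk_lt`). If `κ` is countable, the multiples of
  `S` may lie in a finitely generated group; then some homomorphism to `ℝ` is unbounded on them, and
  a small multiple of it takes every value modulo `1` at the next point while moving the previous
  ones only slightly (`exists_mem_characters_small_of_finite`). Finitely many corrections are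
  summed, and compactness of the group of characters gives infinitely many conditions at once.
* *Generic characters.* As in the Hewitt–Marczewski–Pondiczery theorem, there are `κ` functions on
  an index set of size `2 ^ κ` that approximate every finite pattern. Prescribing their values at
  the interpolation points gives `2 ^ κ` characters under which `S` is dense in the power of the
  circle. The interpolation points lie in a subgroup `H` of size `κ` generated by elements of `S`,
  and the characters can also be made to separate the points of `H`
  (`exists_characters_generic`).
* *Injectivity on `G`.* Half of these characters give a homomorphism `f₀` that is injective on `H`,
  hence whose kernel meets `H` trivially. Every abelian group of size at most `2 ^ 2 ^ κ` embeds into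
  the power of the circle with exponent `2 ^ κ` (`exists_injective_hom_pi_unitAddCircle`), so the
  other half can be changed off `H` to be injective on `ker f₀`
  (`exists_hom_eqOn_injective_prod`).
-/

/-! ### Extending homomorphisms into divisible groups -/

/-- A homomorphism `ψ` into a divisible group factors through `π` as soon as `ker π ≤ ker ψ`, even
if `π` is not surjective. -/
theorem AddMonoidHom.exists_comp_eq_of_ker_le {A B Q : Type*} [AddCommGroup A] [AddCommGroup B]
    [AddCommGroup Q] [DivisibleBy Q ℤ] (π : A →+ B) (ψ : A →+ Q)
    (h : ∀ a, π a = 0 → ψ a = 0) : ∃ χ : B →+ Q, ∀ a, χ (π a) = ψ a := by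
  obtain ⟨χ, hχ⟩ := (Module.Baer.of_divisible Q).extension_property_addMonoidHom
    (QuotientAddGroup.kerLift π) (QuotientAddGroup.kerLift_injective π)
    (QuotientAddGroup.lift π.ker ψ fun a ha => h a ha)
  exact ⟨χ, fun a => DFunLike.congr_fun hχ (QuotientAddGroup.mk a)⟩

/-- The coordinatewise form of `AddMonoidHom.exists_comp_eq_of_ker_le`, for powers of a divisible
group. -/
theorem AddMonoidHom.exists_comp_eq_of_ker_le_pi {A B Q J : Type*} [AddCommGroup A]
    [AddCommGroup B] [AddCommGroup Q] [DivisibleBy Q ℤ] (π : A →+ B) (ψ : A →+ (J → Q))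
    (h : ∀ a, π a = 0 → ψ a = 0) : ∃ χ : B →+ (J → Q), ∀ a, χ (π a) = ψ a := by
  choose χ hχ using fun j => AddMonoidHom.exists_comp_eq_of_ker_le π
    ((Pi.evalAddMonoidHom (fun _ : J => Q) j).comp ψ) (fun a ha => by simp [h a ha])
  exact ⟨AddMonoidHom.pi χ, fun a => funext fun j => hχ j a⟩

/-- A homomorphism to a divisible group extends from a subgroup. -/
theorem AddSubgroup.exists_extension {B Q : Type*} [AddCommGroup B]
    [AddCommGroup Q] [DivisibleBy Q ℤ] (H : AddSubgroup B) (ψ : H →+ Q) :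
    ∃ χ : B →+ Q, ∀ a : H, χ a = ψ a :=
  AddMonoidHom.exists_comp_eq_of_ker_le H.subtype ψ fun a ha => by
    have : a = 0 := by simpa using ha
    simp [this]

/-! ### Characters that are small on a given set and arbitrary at one point -/

/-- The `m`-torsion points of the circle are `1 / m`-dense. -/
theorem UnitAddCircle.exists_nsmul_eq_zero_norm_sub_le {m : ℕ} (hm : 0 < m) (y : UnitAddCircle) :
    ∃ z : UnitAddCircle, m • z = 0 ∧ ‖z - y‖ ≤ 1 / m := by
  have hm' : (0 : ℝ) < m := by exact_mod_cast hm
  obtain ⟨r, rfl⟩ := QuotientAddGroup.mk_surjective y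
  refine ⟨((round (r * m) / m : ℝ) : UnitAddCircle), ?_, ?_⟩
  · rw [← AddCircle.coe_nsmul, nsmul_eq_mul, mul_div_cancel₀ _ hm'.ne']
    exact AddCircle.coe_eq_zero_iff 1 |>.2 ⟨round (r * m), by simp⟩
  · have h1 : ‖(((round (r * m) / m : ℝ) - r : ℝ) : UnitAddCircle)‖ ≤
        |(round (r * m) / m : ℝ) - r| := by
      rw [← Real.norm_eq_abs]
      exact QuotientAddGroup.norm_mk_le_norm
    refine le_trans h1 ?_
    have h2 : (round (r * m) / m : ℝ) - r = (round (r * m) - r * m) / m := by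
      field_simp
    rw [h2, abs_div, abs_of_pos hm', abs_sub_comm]
    gcongr
    exact (abs_sub_round _).trans (by norm_num)

/-- If the factorial of `N` does not multiply `s` into `H`, then `s` has order larger than `N`
modulo `H`, so that characters vanishing on `H` take `1 / N`-dense values at `s`. -/
theorem exists_character_vanishing_on {G : Type*} [AddCommGroup G] (H : AddSubgroup G) (s : G)
    {N : ℕ} (hN : 0 < N) (hs : N.factorial • s ∉ H) (y : UnitAddCircle) :
    ∃ χ : G →+ UnitAddCircle, (∀ x ∈ H, χ x = 0) ∧ ‖χ s - y‖ ≤ 1 / N := by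
  obtain ⟨z, hz, hzy⟩ : ∃ z : UnitAddCircle,
      (∀ k : ℤ, k • s ∈ H → k • z = 0) ∧ ‖z - y‖ ≤ 1 / N := by
    have key : ∀ k : ℤ, k • s ∈ H ↔
        (addOrderOf (QuotientAddGroup.mk s : G ⧸ H) : ℤ) ∣ k := fun k => by
      rw [addOrderOf_dvd_iff_zsmul_eq_zero, ← QuotientAddGroup.mk_zsmul,
        QuotientAddGroup.eq_zero_iff]
    generalize addOrderOf (QuotientAddGroup.mk s : G ⧸ H) = m at key
    rcases Nat.eq_zero_or_pos m with rfl | hm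
    · refine ⟨y, fun k hk => ?_, by simp⟩
      have : k = 0 := by simpa using (key k).1 hk
      simp [this]
    · have hNm : N < m := by
        by_contra! h
        refine hs ?_
        have := (key (N.factorial : ℤ)).2 (by exact_mod_cast Nat.dvd_factorial hm h)
        simpa using this
      obtain ⟨z, hz, hzy⟩ := UnitAddCircle.exists_nsmul_eq_zero_norm_sub_le hm y
      refine ⟨z, fun k hk => ?_, hzy.trans ?_⟩
      · obtain ⟨l, rfl⟩ := (key k).1 hk
        rw [mul_comm, mul_smul, natCast_zsmul, hz, smul_zero]
      · have : (0 : ℝ) < N := by exact_mod_cast hN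
        gcongr
  let π : H × ℤ →+ G := H.subtype.coprod (zmultiplesHom G s)
  let ψ : H × ℤ →+ UnitAddCircle := (0 : H →+ UnitAddCircle).coprod (zmultiplesHom _ z)
  obtain ⟨χ, hχ⟩ := AddMonoidHom.exists_comp_eq_of_ker_le π ψ (by
    rintro ⟨a, k⟩ h
    have h' : (a : G) + k • s = 0 := by simpa [π] using h
    have : k • z = 0 := hz k (by
      rw [← neg_eq_of_add_eq_zero_right h']
      exact H.neg_mem a.2)
    simpa [ψ] using this)
  refine ⟨χ, fun x hx => by simpa [π, ψ] using hχ (⟨x, hx⟩, 0), ?_⟩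
  have : χ s = z := by simpa [π, ψ] using hχ (0, 1)
  rwa [this]

/-- On a finitely generated abelian group, an infinite set is unbounded under some integer-valued
homomorphism. -/
theorem exists_hom_int_image_infinite {H : Type*} [AddCommGroup H] [AddGroup.FG H] {X : Set H}
    (hX : X.Infinite) : ∃ ψ : H →+ ℤ, (ψ '' X).Infinite := by
  obtain ⟨n, ι, _, p, hp, e, ⟨f⟩⟩ := AddCommGroup.equiv_free_prod_directSum_zmod H
  by_contra! hfin
  have : ∀ i, NeZero (p i ^ e i) := fun i => ⟨pow_ne_zero _ (hp i).ne_zero⟩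
  have : Finite (DirectSum ι fun i => ZMod (p i ^ e i)) :=
    Finite.of_equiv _ (DirectSum.addEquivProd fun i => ZMod (p i ^ e i)).symm.toEquiv
  have h1 : ((fun x => (f x).1) '' X).Finite := by
    have h2 : ((fun x => ((f x).1 : Fin n → ℤ)) '' X).Finite := by
      refine Set.Finite.subset (Set.Finite.pi' (t := fun i => (fun x => (f x).1 i) '' X)
        fun i => ?_) ?_
      · exact hfin (((Finsupp.applyAddHom i).comp (AddMonoidHom.fst _ _)).comp f.toAddMonoidHom)
      · rintro _ ⟨x, hx, rfl⟩ i
        exact ⟨x, hx, rfl⟩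
    refine Set.Finite.of_finite_image (f := fun v : Fin n →₀ ℤ => (v : Fin n → ℤ)) ?_
      DFunLike.coe_injective.injOn
    rwa [Set.image_image]
  refine hX (Set.Finite.of_finite_image (f := f) ?_ f.injective.injOn)
  refine (h1.prod (Set.finite_univ (α := DirectSum ι fun i => ZMod (p i ^ e i)))).subset ?_
  rintro _ ⟨x, hx, rfl⟩
  exact ⟨⟨x, hx, rfl⟩, trivial⟩

/-- If no `n • S` is finite, then for some `s ∈ S` the characters that are small on a given finite
set take almost arbitrary values at `s`. Either multiples of `S` escape the subgroup generated by
the finite set, or this subgroup has a real-valued homomorphism that is unbounded on them, and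
then a small multiple of it does. -/
theorem exists_mem_characters_small_of_finite {G : Type*} [AddCommGroup G] {S : Set G}
    (hS : ∀ n : ℕ, 1 ≤ n → (multSet n S).Infinite) {Z : Type*} [Finite Z] (a : Z → G)
    {δ : Z → ℝ} (hδ : ∀ z, 0 < δ z) {ε : ℝ} (hε : 0 < ε) :
    ∃ s ∈ S, ∀ y : UnitAddCircle, ∃ χ : G →+ UnitAddCircle,
      ‖χ s - y‖ ≤ ε ∧ ∀ z, ‖χ (a z)‖ ≤ δ z := by
  obtain ⟨N, hN⟩ := exists_nat_one_div_lt hε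
  have hN' : 1 / ((N + 1 : ℕ) : ℝ) < ε := by exact_mod_cast hN
  set M := (N + 1).factorial with hM
  let H := AddSubgroup.closure (Set.range a)
  have haH : ∀ z, a z ∈ H := fun z => AddSubgroup.subset_closure ⟨z, rfl⟩
  by_cases hcase : ∃ s ∈ S, M • s ∉ H
  · obtain ⟨s, hs, hsH⟩ := hcase
    refine ⟨s, hs, fun y => ?_⟩
    obtain ⟨χ, hχ, hχs⟩ := exists_character_vanishing_on H s N.succ_pos hsH y
    exact ⟨χ, hχs.trans hN'.le, fun z => by simp [hχ _ (haH z), (hδ z).le]⟩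
  -- Now all `M • s` lie in the finitely generated group `H`. A homomorphism `ψ : H → ℤ` that is
  -- unbounded on them extends to `Ψ : G → ℝ`, and the characters used are `(r / Ψ s) • Ψ` modulo `1`
  -- with `|r| ≤ 1`, which are small on `a` once `Ψ s` is large compared with the values `Ψ (a z)`.
  push Not at hcase
  have hMpos : (0 : ℝ) < M := by exact_mod_cast Nat.factorial_pos _
  let X : Set H := Subtype.val ⁻¹' multSet M S
  have hX : X.Infinite := by
    refine (hS M (Nat.factorial_pos _)).preimage ?_
    rintro _ ⟨s, hs, rfl⟩
    exact ⟨⟨_, hcase s hs⟩, rfl⟩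
  have : AddGroup.FG H := (AddGroup.fg_iff_addSubgroup_fg H).2
    ((AddSubgroup.fg_iff _).2 ⟨_, rfl, Set.finite_range a⟩)
  obtain ⟨ψ, hψ⟩ := exists_hom_int_image_infinite hX
  obtain ⟨Ψ, hΨ⟩ := H.exists_extension ((Int.castAddHom ℝ).comp ψ)
  obtain ⟨B, hB0, hB⟩ : ∃ B : ℝ, 0 < B ∧ ∀ z, |Ψ (a z)| ≤ δ z * B := by
    obtain ⟨B, hB⟩ := (Set.finite_range fun z => |Ψ (a z)| / δ z).bddAbove
    refine ⟨max B 1, by positivity, fun z => ?_⟩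
    have := (hB ⟨z, rfl⟩).trans (le_max_left B 1)
    rwa [div_le_iff₀ (hδ z), mul_comm] at this
  obtain ⟨k, ⟨x, hx, rfl⟩, hk⟩ : ∃ k ∈ ψ '' X, M * B < |(k : ℝ)| := by
    by_contra! h
    refine hψ ((Set.finite_Icc (-⌈M * B⌉) ⌈M * B⌉).subset fun k hk => ?_)
    rw [Set.mem_Icc, ← abs_le]
    exact_mod_cast (h k hk).trans (Int.le_ceil _)
  obtain ⟨s, hs, hsx⟩ := hx
  have hΨs : B < |Ψ s| := by
    have h1 : (M : ℝ) * Ψ s = ψ x := by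
      have h2 : Ψ (M • s) = ψ x := by
        have h3 : M • s = (x : G) := hsx
        rw [h3]
        simpa using hΨ x
      rw [← h2, map_nsmul, nsmul_eq_mul]
    rw [← h1, abs_mul, abs_of_pos hMpos] at hk
    exact lt_of_mul_lt_mul_left hk hMpos.le
  have hΨ0 : Ψ s ≠ 0 := fun h => by
    rw [h, abs_zero] at hΨs
    exact hB0.not_gt hΨs
  refine ⟨s, hs, fun y => ?_⟩
  obtain ⟨r, hr, rfl⟩ : ∃ r : ℝ, |r| ≤ 1 ∧ (r : UnitAddCircle) = y := by
    obtain ⟨r, hr, h⟩ := (AddCircle.eq_coe_Ico y)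
    exact ⟨r, by rw [abs_of_nonneg hr.1]; exact hr.2.le, h⟩
  refine ⟨(QuotientAddGroup.mk' _).comp ((AddMonoidHom.mulLeft (r / Ψ s)).comp Ψ), ?_, fun z => ?_⟩
  · have : (QuotientAddGroup.mk' (AddSubgroup.zmultiples (1 : ℝ))) (r / Ψ s * Ψ s) =
      (r : UnitAddCircle) := by rw [div_mul_cancel₀ _ hΨ0]; rfl
    simp only [AddMonoidHom.comp_apply, AddMonoidHom.coe_mulLeft]
    rw [this, sub_self, norm_zero]
    exact hε.le
  · refine QuotientAddGroup.norm_mk_le_norm.trans ?_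
    simp only [AddMonoidHom.comp_apply, AddMonoidHom.coe_mulLeft, Real.norm_eq_abs, abs_mul,
      abs_div]
    rw [div_mul_eq_mul_div, div_le_iff₀ (abs_pos.2 hΨ0)]
    calc |r| * |Ψ (a z)| ≤ 1 * (δ z * B) := by gcongr; exact hB z
      _ ≤ δ z * |Ψ s| := by rw [one_mul]; have := (hδ z).le; gcongr

/-- A subgroup generated by a family `a : Z → G` has at most `max #Z ℵ₀` elements. -/
theorem mk_span_range_le {G Z : Type u} [AddCommGroup G] (a : Z → G) :
    #(Submodule.span ℤ (Set.range a)) ≤ max #Z ℵ₀ := by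
  rw [← Finsupp.range_linearCombination]
  refine (mk_range_le (f := Finsupp.linearCombination ℤ a)).trans ?_
  rcases isEmpty_or_nonempty Z with h | h
  · exact ((le_one_iff_subsingleton.2 inferInstance).trans one_le_aleph0).trans (le_max_right _ _)
  · simp

/-- If every `n • S` has more than `max #Z ℵ₀` elements, then for some `s ∈ S` the characters that
vanish on a given family indexed by `Z` take almost arbitrary values at `s`. -/
theorem exists_mem_characters_vanishing_of_mk_lt {G Z : Type u} [AddCommGroup G] {S : Set G}
    (hS : ∀ n : ℕ, 1 ≤ n → max #Z ℵ₀ < #(multSet n S)) (a : Z → G) {ε : ℝ} (hε : 0 < ε) :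
    ∃ s ∈ S, ∀ y : UnitAddCircle, ∃ χ : G →+ UnitAddCircle,
      ‖χ s - y‖ ≤ ε ∧ ∀ z, χ (a z) = 0 := by
  obtain ⟨N, hN⟩ := exists_nat_one_div_lt hε
  have hN' : 1 / ((N + 1 : ℕ) : ℝ) < ε := by exact_mod_cast hN
  set H := Submodule.span ℤ (Set.range a) with hH
  obtain ⟨s, hs, hsH⟩ : ∃ s ∈ S, (N + 1).factorial • s ∉ H.toAddSubgroup := by
    by_contra! h
    refine (hS _ (Nat.factorial_pos (N + 1))).not_ge (le_trans ?_ (mk_span_range_le a))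
    refine mk_le_mk_of_subset ?_
    rintro _ ⟨s, hs, rfl⟩
    exact h s hs
  refine ⟨s, hs, fun y => ?_⟩
  obtain ⟨χ, hχ, hχs⟩ := exists_character_vanishing_on _ s N.succ_pos hsH y
  exact ⟨χ, hχs.trans hN'.le, fun z => hχ _ (Submodule.subset_span ⟨z, rfl⟩)⟩

/-! ### Points at which characters can be prescribed simultaneously -/

/-- Characters into the circle separate the points of an abelian group. -/
theorem exists_character_ne_zero {G : Type*} [AddCommGroup G] {g : G} (hg : g ≠ 0) :
    ∃ χ : G →+ UnitAddCircle, χ g ≠ 0 := by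
  obtain ⟨z, hz0, hz⟩ : ∃ z : UnitAddCircle, z ≠ 0 ∧ ∀ k : ℤ, k • g = 0 → k • z = 0 := by
    have hm1 : addOrderOf g ≠ 1 := fun h => hg (AddMonoid.addOrderOf_eq_one_iff.1 h)
    have key : ∀ k : ℤ, k • g = 0 ↔ (addOrderOf g : ℤ) ∣ k := fun k =>
      addOrderOf_dvd_iff_zsmul_eq_zero.symm
    generalize addOrderOf g = m at hm1 key
    have horder : ∀ n : ℕ, 0 < n → addOrderOf ((1 / n : ℝ) : UnitAddCircle) = n := fun n hn =>
      AddCircle.addOrderOf_period_div hn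
    rcases Nat.eq_zero_or_pos m with rfl | hm
    · refine ⟨((1 / (2 : ℕ) : ℝ) : UnitAddCircle), fun h => ?_, fun k hk => ?_⟩
      · have := horder 2 two_pos
        rw [h, addOrderOf_zero] at this
        omega
      · have : k = 0 := by simpa using (key k).1 hk
        simp [this]
    · refine ⟨((1 / m : ℝ) : UnitAddCircle), fun h => ?_, fun k hk => ?_⟩
      · have := horder m hm
        rw [h, addOrderOf_zero] at this
        omega
      · rw [← addOrderOf_dvd_iff_zsmul_eq_zero, horder m hm]
        exact (key k).1 hk
  obtain ⟨χ, hχ⟩ := AddMonoidHom.exists_comp_eq_of_ker_le (zmultiplesHom G g)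
    (zmultiplesHom UnitAddCircle z) (fun k hk => by simpa using hz k (by simpa using hk))
  refine ⟨χ, ?_⟩
  have : χ g = z := by simpa using hχ 1
  rwa [this]

/-- The countable and the uncountable selection principles in a common form: `δ` vanishes in the
uncountable case, and is positive and summable in the countable case. -/
theorem exists_mem_characters_small {G ι : Type u} [AddCommGroup G] {κ : Cardinal.{u}}
    (hκ : ℵ₀ ≤ κ) {S : Set G} (hS : ∀ n : ℕ, 1 ≤ n → κ ≤ #(multSet n S))
    [LinearOrder ι] (hι : #ι = κ) (hinit : ∀ s : ι, #(Set.Iio s) < κ) :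
    ∃ δ : ι → ℝ, (∀ s, 0 ≤ δ s) ∧ (∀ A : Finset ι, ∑ s ∈ A, δ s ≤ 1 / 2) ∧
      ∀ (s : ι) (a : Set.Iio s ⊕ Set.Iio s → G) (b : Set.Iio s ⊕ Set.Iio s → ℝ), (∀ z, 0 < b z) →
        ∀ ε : ℝ, 0 < ε → ∃ x ∈ S, ∀ y : UnitAddCircle, ∃ χ : G →+ UnitAddCircle,
          ‖χ x - y‖ ≤ ε ∧ ∀ z, ‖χ (a z)‖ ≤ δ s * b z := by
  rcases hκ.eq_or_lt with rfl | hlt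
  · have hc : (Set.univ : Set ι).Countable := by
      rw [← Cardinal.le_aleph0_iff_set_countable, mk_univ, hι]
    obtain ⟨δ, hδ, c, hc, hc'⟩ := hc.exists_pos_hasSum_le (show (0 : ℝ) < 1 / 2 by norm_num)
    have hsum : ∀ A : Finset ι, ∑ s ∈ A, δ s ≤ 1 / 2 := fun A => by
      have h := (Equiv.Set.univ ι).hasSum_iff (f := δ) (a := c) |>.1 hc
      exact (sum_le_hasSum A (fun s _ => (hδ s).le) h).trans hc'
    refine ⟨δ, fun s => (hδ s).le, hsum, fun s a b hb ε hε => ?_⟩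
    have : Finite (Set.Iio s) := Cardinal.lt_aleph0_iff_finite.1 (hinit s)
    exact exists_mem_characters_small_of_finite
      (fun n hn => Set.infinite_coe_iff.1 (Cardinal.infinite_iff.2 (hS n hn))) a
      (fun z => mul_pos (hδ s) (hb z)) hε
  · refine ⟨0, fun s => le_rfl, fun A => by simp, fun s a b hb ε hε => ?_⟩
    obtain ⟨x, hx, h⟩ := exists_mem_characters_vanishing_of_mk_lt (Z := Set.Iio s ⊕ Set.Iio s)
      (fun n hn => (max_lt (by
        simp only [mk_sum, lift_id]
        exact add_lt_of_lt hκ (hinit s) (hinit s)) hlt).trans_le (hS n hn)) a hε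
    refine ⟨x, hx, fun y => ?_⟩
    obtain ⟨χ, hχ, h0⟩ := h y
    exact ⟨χ, hχ, fun z => by simp [h0 z]⟩

/-- Suppose that the values at `e s` can be corrected by characters that move the earlier values
`e t`, `h t` by at most `δ s` times the allowed tolerance. By induction along the order finitely
many values can be prescribed, starting from a given character `u`. -/
theorem exists_character_approx_finset {G ι : Type*} [AddCommGroup G] [LinearOrder ι]
    {δ ε c : ι → ℝ} (hδ : ∀ s, 0 ≤ δ s) (hε : ∀ s, 0 ≤ ε s) {e h : ι → G}
    (hstep : ∀ s, ∀ y : UnitAddCircle, ∃ χ : G →+ UnitAddCircle, ‖χ (e s) - y‖ ≤ ε s / 2 ∧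
      ∀ t < s, ‖χ (e t)‖ ≤ δ s * ε t ∧ ‖χ (h t)‖ ≤ δ s * c t)
    (y : ι → UnitAddCircle) (t : ι) (u : G →+ UnitAddCircle) (A : Finset ι)
    (hA : ∀ s ∈ A, t < s) :
    ∃ χ : G →+ UnitAddCircle, ‖χ (h t) - u (h t)‖ ≤ (∑ s ∈ A, δ s) * c t ∧
      ∀ s ∈ A, ‖χ (e s) - y s‖ ≤ (1 / 2 + ∑ s ∈ A, δ s) * ε s := by
  induction A using Finset.induction_on_max with
  | empty => exact ⟨u, by simp, by simp⟩
  | insert m A hm ih =>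
    obtain ⟨χ, hχt, hχ⟩ := ih fun s hs => hA s (Finset.mem_insert_of_mem hs)
    obtain ⟨w, hwm, hw⟩ := hstep m (y m - χ (e m))
    have hmA : m ∉ A := fun h => (hm m h).false
    have hsum : 0 ≤ ∑ s ∈ A, δ s := Finset.sum_nonneg fun s _ => hδ s
    rw [Finset.sum_insert hmA]
    refine ⟨χ + w, ?_, fun s hs => ?_⟩
    · have h1 := (hw t (hA m (Finset.mem_insert_self _ _))).2
      calc ‖(χ + w) (h t) - u (h t)‖ = ‖w (h t) + (χ (h t) - u (h t))‖ := by
            rw [AddMonoidHom.add_apply]; congr 1; abel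
        _ ≤ ‖w (h t)‖ + ‖χ (h t) - u (h t)‖ := norm_add_le _ _
        _ ≤ _ := by rw [add_mul]; gcongr
    · rcases Finset.mem_insert.1 hs with rfl | hs
      · calc ‖(χ + w) (e s) - y s‖ = ‖w (e s) - (y s - χ (e s))‖ := by
              rw [AddMonoidHom.add_apply]; congr 1; abel
          _ ≤ ε s / 2 := hwm
          _ ≤ _ := by nlinarith [hδ s, hε s, mul_nonneg (add_nonneg (hδ s) hsum) (hε s)]
      · have h1 := (hw s (hm s hs)).1
        have h2 := hχ s hs
        calc ‖(χ + w) (e s) - y s‖ = ‖w (e s) + (χ (e s) - y s)‖ := by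
              rw [AddMonoidHom.add_apply]; congr 1; abel
          _ ≤ ‖w (e s)‖ + ‖χ (e s) - y s‖ := norm_add_le _ _
          _ ≤ δ m * ε s + (1 / 2 + ∑ s ∈ A, δ s) * ε s := add_le_add h1 h2
          _ = _ := by ring

/-- Compactness of the group of all characters of `G`: closed conditions at the points of two
families can be met by a character if every finite part of them can. -/
theorem exists_character_of_finset {G ι : Type*} [AddCommGroup G] (g : G) (v : UnitAddCircle)
    (r : ℝ) (T : Set ι) (e : ι → G) (y : ι → UnitAddCircle) (ε : ι → ℝ)
    (hfin : ∀ A : Finset ι, ↑A ⊆ T → ∃ χ : G →+ UnitAddCircle, ‖χ g - v‖ ≤ r ∧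
      ∀ s ∈ A, ‖χ (e s) - y s‖ ≤ ε s) :
    ∃ χ : G →+ UnitAddCircle, ‖χ g - v‖ ≤ r ∧ ∀ s ∈ T, ‖χ (e s) - y s‖ ≤ ε s := by
  classical
  let C : Finset T → Set (G → UnitAddCircle) := fun A =>
    Set.range ((↑) : (G →+ UnitAddCircle) → G → UnitAddCircle) ∩
      ({f | ‖f g - v‖ ≤ r} ∩ ⋂ s ∈ A, {f | ‖f (e s) - y s‖ ≤ ε s})
  have hclosed : ∀ A, IsClosed (C A) := fun A => by
    refine (AddMonoidHom.isClosed_range_coe G UnitAddCircle).inter (IsClosed.inter ?_ ?_)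
    · exact isClosed_le (by fun_prop) (by fun_prop)
    · exact isClosed_biInter fun s _ => isClosed_le (by fun_prop) (by fun_prop)
  obtain ⟨f, hf⟩ := IsCompact.nonempty_iInter_of_directed_nonempty_isCompact_isClosed C
    (by
      have : Antitone C := fun A B hAB f hf =>
        ⟨hf.1, hf.2.1, Set.biInter_subset_biInter_left hAB hf.2.2⟩
      exact this.directed_ge)
    (fun A => by
      obtain ⟨χ, hχ, hχA⟩ := hfin (A.map (Function.Embedding.subtype _))
        (fun s hs => Finset.property_of_mem_map_subtype A hs)
      refine ⟨χ, ⟨χ, rfl⟩, hχ, Set.mem_iInter₂.2 fun s hs => ?_⟩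
      exact hχA s (Finset.mem_map_of_mem _ hs))
    (fun A => (hclosed A).isCompact) hclosed
  rw [Set.mem_iInter] at hf
  obtain ⟨χ, rfl⟩ := (hf ∅).1
  refine ⟨χ, (hf ∅).2.1, fun s hs => ?_⟩
  exact Set.mem_iInter₂.1 (hf {⟨s, hs⟩}).2.2 ⟨s, hs⟩ (Finset.mem_singleton_self _)

/-- If all `n • S` have at least `κ` elements, there are points `e s ∈ S`, indexed by a well-order
of type `κ`, at which characters take arbitrary prescribed values up to `ε s`. Moreover the
character can be nonzero at `h t`, if only the values at `e s` with `t < s` are prescribed. -/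
theorem exists_interpolation_points {G ι : Type u} [AddCommGroup G] {κ : Cardinal.{u}}
    (hκ : ℵ₀ ≤ κ) {S : Set G} (hS : ∀ n : ℕ, 1 ≤ n → κ ≤ #(multSet n S))
    [LinearOrder ι] [WellFoundedLT ι] (hι : #ι = κ) (hinit : ∀ s : ι, #(Set.Iio s) < κ)
    {ε : ι → ℝ} (hε : ∀ s, 0 < ε s) (h : ι → G) :
    ∃ e : ι → G, (∀ s, e s ∈ S) ∧ ∀ (y : ι → UnitAddCircle) (t : ι), ∃ χ : G →+ UnitAddCircle,
      (h t ≠ 0 → χ (h t) ≠ 0) ∧ ∀ s, t < s → ‖χ (e s) - y s‖ ≤ ε s := by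
  obtain ⟨δ, hδ, hδsum, hsel⟩ := exists_mem_characters_small hκ hS hι hinit
  have hu : ∀ t, ∃ (u : G →+ UnitAddCircle) (c : ℝ), 0 < c ∧ (h t ≠ 0 → ‖u (h t)‖ = c) := by
    intro t
    by_cases ht : h t = 0
    · exact ⟨0, 1, one_pos, fun h' => (h' ht).elim⟩
    · obtain ⟨u, hu⟩ := exists_character_ne_zero ht
      exact ⟨u, ‖u (h t)‖, norm_pos_iff.2 hu, fun _ => rfl⟩
  choose u c hc huc using hu
  have hsel' : ∀ s (a : Set.Iio s → G), ∃ x ∈ S, ∀ y : UnitAddCircle, ∃ χ : G →+ UnitAddCircle,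
      ‖χ x - y‖ ≤ ε s / 2 ∧ ∀ t : Set.Iio s,
        ‖χ (a t)‖ ≤ δ s * ε t ∧ ‖χ (h t)‖ ≤ δ s * c t := fun s a => by
    obtain ⟨x, hx, hxy⟩ := hsel s (Sum.elim a fun t => h t)
      (Sum.elim (fun t => ε t) fun t => c t) (by simp [hε, hc]) (ε s / 2) (half_pos (hε s))
    refine ⟨x, hx, fun y => ?_⟩
    obtain ⟨χ, h1, h2⟩ := hxy y
    exact ⟨χ, h1, fun t => ⟨h2 (Sum.inl t), h2 (Sum.inr t)⟩⟩
  choose pick hpickS hpick using hsel'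
  let e : ι → G := (wellFounded_lt (α := ι)).fix fun s prev => pick s fun t => prev t t.2
  have he : ∀ s, e s = pick s fun t => e t := fun s => WellFounded.fix_eq _ _ s
  refine ⟨e, fun s => by rw [he]; exact hpickS _ _, fun y t => ?_⟩
  have hstep : ∀ s, ∀ y : UnitAddCircle, ∃ χ : G →+ UnitAddCircle, ‖χ (e s) - y‖ ≤ ε s / 2 ∧
      ∀ t < s, ‖χ (e t)‖ ≤ δ s * ε t ∧ ‖χ (h t)‖ ≤ δ s * c t := fun s y => by
    obtain ⟨χ, h1, h2⟩ := hpick s (fun t => e t) y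
    exact ⟨χ, by rwa [he], fun t ht => h2 ⟨t, ht⟩⟩
  obtain ⟨χ, hχt, hχ⟩ := exists_character_of_finset (h t) (u t (h t)) (1 / 2 * c t) (Set.Ioi t)
    e y ε fun A hA => by
      obtain ⟨χ, h1, h2⟩ := exists_character_approx_finset hδ (fun s => (hε s).le) hstep y t
        (u t) A hA
      refine ⟨χ, h1.trans ?_, fun s hs => (h2 s hs).trans ?_⟩
      · have := (hc t).le
        gcongr
        exact hδsum A
      · have := hδsum A
        exact mul_le_of_le_one_left (hε s).le (by linarith)
  refine ⟨χ, fun hne h0 => ?_, hχ⟩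
  rw [h0, zero_sub, norm_neg, huc t hne] at hχt
  linarith [hc t]

/-! ### Small abelian groups embed into powers of the circle -/

open Classical in
/-- The trace of a set `i` on a finite set `A`, as a finite set. -/
noncomputable def setTrace {J : Type*} (A : Finset J) (i : Set J) : Finset J :=
  {x ∈ A | x ∈ i}

theorem mem_setTrace {J : Type*} {A : Finset J} {i : Set J} {x : J} :
    x ∈ setTrace A i ↔ x ∈ A ∧ x ∈ i := by
  classical
  simp [setTrace]

/-- Finitely many sets are distinguished by their traces on a suitable finite set. -/
theorem exists_injOn_setTrace {J : Type*} (P : Finset (Set J)) :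
    ∃ A : Finset J, Set.InjOn (setTrace A) (P : Set (Set J)) := by
  classical
  have h : ∀ p q : Set J, ∃ a : Finset J, p ≠ q → ∃ x ∈ a, ¬(x ∈ p ↔ x ∈ q) := fun p q => by
    by_cases hpq : p = q
    · exact ⟨∅, fun h => (h hpq).elim⟩
    · obtain ⟨x, hx⟩ : ∃ x, ¬(x ∈ p ↔ x ∈ q) := by
        by_contra! hx
        exact hpq (Set.ext hx)
      exact ⟨{x}, fun _ => ⟨x, Finset.mem_singleton_self x, hx⟩⟩
  choose a ha using h
  refine ⟨P.biUnion fun p => P.biUnion fun q => a p q, fun p hp q hq hpq => ?_⟩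
  by_contra hne
  obtain ⟨x, hxa, hx⟩ := ha p q hne
  have hxA : x ∈ P.biUnion fun p => P.biUnion fun q => a p q := by
    simp only [Finset.mem_biUnion]
    exact ⟨p, hp, q, hq, hxa⟩
  have := Finset.ext_iff.1 hpq x
  simp only [mem_setTrace, hxA, true_and] at this
  exact hx this

/-- A direct sum of at most `2 ^ #J` circles has `#J` characters that separate its points: an
injection `B → Set J` is used to add up the coordinates in `B` according to traces on finite
subsets of `J`. Such characters extend from a subgroup `P` to the whole group. -/
theorem exists_hom_pi_injOn_of_hom_finsupp {N B J : Type*} [AddCommGroup N] (P : AddSubgroup N)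
    (θ : P →+ B →₀ UnitAddCircle) (hθ : Function.Injective θ) (a : B → Set J)
    (ha : Function.Injective a) :
    ∃ φ : N →+ (Finset J × Finset J → UnitAddCircle), ∀ x ∈ P, φ x = 0 → x = 0 := by
  classical
  -- The character with index `(A, Q)` adds up the coordinates `b` for which `a b` has trace `Q` on `A`.
  let ψ : P →+ (Finset J × Finset J → UnitAddCircle) := AddMonoidHom.pi fun q =>
    ((Finsupp.applyAddHom q.2).comp
      (Finsupp.mapDomain.addMonoidHom fun b => setTrace q.1 (a b))).comp θ
  obtain ⟨φ, hφ⟩ := AddMonoidHom.exists_comp_eq_of_ker_le_pi P.subtype ψ fun x hx => by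
    have : x = 0 := by simpa using hx
    simp [this]
  refine ⟨φ, fun x hx h0 => ?_⟩
  have h1 : ψ ⟨x, hx⟩ = 0 := by rw [← hφ]; exact h0
  obtain ⟨A, hA⟩ := exists_injOn_setTrace ((θ ⟨x, hx⟩).support.image a)
  have h2 : Finsupp.mapDomain (fun b => setTrace A (a b)) (θ ⟨x, hx⟩) =
      Finsupp.mapDomain (fun b => setTrace A (a b)) 0 := by
    rw [Finsupp.mapDomain_zero]
    ext1 q
    exact congrFun h1 (A, q)
  have h3 := Finsupp.mapDomain_injOn ((θ ⟨x, hx⟩).support : Set B)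
    (f := fun b => setTrace A (a b)) (M := UnitAddCircle) (fun b hb c hc h => ha (hA (by simpa using
      ⟨b, by simpa using hb, rfl⟩) (by simpa using ⟨c, by simpa using hc, rfl⟩) h))
    (by simp) (by simp) h2
  have h4 := hθ (h3.trans θ.map_zero.symm)
  exact congrArg Subtype.val h4

/-- The `p`-torsion of an abelian group of size at most `2 ^ #J` is separated by `#J` characters,
since it is a direct sum of groups of order `p`. -/
theorem exists_hom_pi_injOn_torsionBy {N J : Type u} [AddCommGroup N] (hN : #N ≤ 2 ^ #J) {p : ℕ}
    (hp : p.Prime) :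
    ∃ φ : N →+ (Finset J × Finset J → UnitAddCircle), ∀ x, p • x = 0 → φ x = 0 → x = 0 := by
  have : Fact p.Prime := ⟨hp⟩
  let P := AddSubgroup.torsionBy N (p : ℤ)
  let _ : Module (ZMod p) P := AddSubgroup.torsionBy.zmodModule
  let b := Module.Basis.ofVectorSpace (ZMod p) P
  have hB : #(Module.Basis.ofVectorSpaceIndex (ZMod p) P) ≤ #(Set J) := by
    rw [mk_set]
    exact (mk_set_le _).trans ((mk_subtype_le _).trans hN)
  obtain ⟨⟨a, ha⟩⟩ := hB
  obtain ⟨φ, hφ⟩ := exists_hom_pi_injOn_of_hom_finsupp P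
    ((Finsupp.mapRange.addMonoidHom ZMod.toAddCircle).comp b.repr.toLinearMap.toAddMonoidHom)
    ((Finsupp.mapRange_injective _ (map_zero _) (ZMod.toAddCircle_injective p)).comp
      b.repr.injective) a ha
  exact ⟨φ, fun x hx => hφ x (by
    change (p : ℤ) • x = 0
    simpa using hx)⟩

/-- The circle has an element of infinite order. -/
theorem UnitAddCircle.exists_zsmul_injective :
    ∃ z : UnitAddCircle, Function.Injective fun k : ℤ => k • z := by
  refine ⟨((√2 : ℝ) : UnitAddCircle), ?_⟩
  rw [injective_zsmul_iff_not_isOfFinAddOrder, isOfFinAddOrder_iff_nsmul_eq_zero]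
  rintro ⟨n, hn, h⟩
  rw [← AddCircle.coe_nsmul, AddCircle.coe_eq_zero_iff] at h
  obtain ⟨k, hk⟩ := h
  refine irrational_sqrt_two ⟨(k / n : ℚ), ?_⟩
  have : (n : ℝ) ≠ 0 := by exact_mod_cast hn.ne'
  push_cast
  rw [div_eq_iff this]
  simpa [mul_comm] using hk

/-- In an abelian group of size at most `2 ^ #J` some `#J` characters separate the elements of
infinite order from `0`, since each element has a nonzero multiple in the span of a maximal
independent set, and this span is a direct sum of infinite cyclic groups. -/
theorem exists_hom_pi_isOfFinAddOrder {N J : Type u} [AddCommGroup N] (hN : #N ≤ 2 ^ #J) :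
    ∃ φ : N →+ (Finset J × Finset J → UnitAddCircle), ∀ x, φ x = 0 → IsOfFinAddOrder x := by
  obtain ⟨s, hs, hmax⟩ := exists_maximal_linearIndepOn ℤ (fun x : N => x)
  have hs' : LinearIndependent ℤ (fun x : s => (x : N)) := hs
  obtain ⟨⟨a, ha⟩⟩ : #s ≤ #(Set J) := by
    rw [mk_set]
    exact (mk_set_le _).trans hN
  obtain ⟨z, hz⟩ := UnitAddCircle.exists_zsmul_injective
  have hz' : Function.Injective (zmultiplesHom UnitAddCircle z) := fun k l h => hz (by simpa using h)
  obtain ⟨φ, hφ⟩ := exists_hom_pi_injOn_of_hom_finsupp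
    (Submodule.span ℤ (Set.range fun x : s => (x : N))).toAddSubgroup
    ((Finsupp.mapRange.addMonoidHom (zmultiplesHom UnitAddCircle z)).comp
      hs'.linearCombinationEquiv.symm.toLinearMap.toAddMonoidHom)
    ((Finsupp.mapRange_injective _ (map_zero _) hz').comp
      hs'.linearCombinationEquiv.symm.injective) a ha
  refine ⟨φ, fun x hx => ?_⟩
  obtain ⟨k, hk, hkx⟩ : ∃ k : ℤ, k ≠ 0 ∧
      k • x ∈ Submodule.span ℤ (Set.range fun x : s => (x : N)) := by
    by_cases hxs : x ∈ s
    · exact ⟨1, one_ne_zero, by rw [one_smul]; exact Submodule.subset_span ⟨⟨x, hxs⟩, rfl⟩⟩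
    · obtain ⟨k, hk, h⟩ := hmax x hxs
      refine ⟨k, hk, ?_⟩
      rwa [Subtype.range_coe, ← Set.image_id' s]
  exact isOfFinAddOrder_iff_zsmul_eq_zero.2 ⟨k, hk, hφ _ hkx (by rw [map_zsmul, hx, smul_zero])⟩

/-- An abelian group of size at most `2 ^ #J`, with `J` infinite, embeds into the power of the
circle with exponent `J`. -/
theorem exists_injective_hom_pi_unitAddCircle {N J : Type u} [AddCommGroup N] [Infinite J]
    (hN : #N ≤ 2 ^ #J) : ∃ φ : N →+ (J → UnitAddCircle), Function.Injective φ := by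
  have hφ : ∀ n : ℕ, ∃ φ : N →+ (Finset J × Finset J → UnitAddCircle),
      (n = 0 → ∀ x, φ x = 0 → IsOfFinAddOrder x) ∧
      (n.Prime → ∀ x, n • x = 0 → φ x = 0 → x = 0) := fun n => by
    rcases eq_or_ne n 0 with rfl | hn
    · obtain ⟨φ, h⟩ := exists_hom_pi_isOfFinAddOrder hN
      exact ⟨φ, fun _ => h, fun h0 => (Nat.not_prime_zero h0).elim⟩
    · by_cases hp : n.Prime
      · obtain ⟨φ, h⟩ := exists_hom_pi_injOn_torsionBy hN hp
        exact ⟨φ, fun h0 => (hn h0).elim, fun _ => h⟩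
      · exact ⟨0, fun h0 => (hn h0).elim, fun h0 => (hp h0).elim⟩
  -- The index `0` stands for the torsion-free part; primes stand for the primary parts.
  choose φ hφ0 hφp using hφ
  obtain ⟨⟨i, hi⟩⟩ : #(ℕ × Finset J × Finset J) ≤ #J := by
    simp [mul_eq_self (aleph0_le_mk J)]
  have hq := Function.invFun_surjective hi
  refine ⟨AddMonoidHom.pi fun j => (Pi.evalAddMonoidHom _ (Function.invFun i j).2).comp
    (φ (Function.invFun i j).1), (injective_iff_map_eq_zero _).2 fun x hx => ?_⟩
  have h0 : ∀ n, φ n x = 0 := fun n => by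
    ext q
    obtain ⟨j, hj⟩ := hq (n, q)
    have := congrFun hx j
    simpa [hj] using this
  by_contra hne
  have hfin := hφ0 0 rfl x (h0 0)
  have hn1 : addOrderOf x ≠ 1 := fun h => hne (AddMonoid.addOrderOf_eq_one_iff.1 h)
  obtain ⟨p, hp, m, hm⟩ := Nat.exists_prime_and_dvd hn1
  have hpos := hfin.addOrderOf_pos
  have hmx : m • x = 0 := hφp p hp (m • x)
    (by rw [← mul_smul, ← hm, addOrderOf_nsmul_eq_zero]) (by rw [map_nsmul, h0, smul_zero])
  have hm0 : 0 < m := Nat.pos_of_ne_zero fun h => by simp [hm, h] at hpos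
  have := Nat.le_of_dvd hm0 (addOrderOf_dvd_of_nsmul_eq_zero hmx)
  have := hp.two_le
  nlinarith

/-! ### Characters in general position -/

/-- An approximation problem for functions on `Bool × Set ι`, as in the proof of the
Hewitt–Marczewski–Pondiczery theorem: a finite subset of `ι`, a rational value for each trace on it
(and each Boolean), and a number `n` that stands for the tolerance `1 / (n + 1)`. -/
abbrev ApproxTask (ι : Type u) := Finset ι × (Bool × Finset ι →₀ ℚ) × ℕ

/-- The function on `Bool × Set ι` that an approximation problem asks to approximate; its value at
`(b, i)` depends only on `b` and a finite trace of `i`. -/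
noncomputable def ApproxTask.target {ι : Type u} (r : ApproxTask ι) (i : Bool × Set ι) :
    UnitAddCircle :=
  ((r.2.1 (i.1, setTrace r.1 i.2) : ℝ) : UnitAddCircle)

theorem UnitAddCircle.exists_rat_norm_sub_le (y : UnitAddCircle) {ε : ℝ} (hε : 0 < ε) :
    ∃ q : ℚ, ‖((q : ℝ) : UnitAddCircle) - y‖ ≤ ε := by
  obtain ⟨r, rfl⟩ := QuotientAddGroup.mk_surjective y
  obtain ⟨q, hq1, hq2⟩ := exists_rat_btwn (lt_add_of_pos_right r hε)
  refine ⟨q, ?_⟩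
  have h : ‖(((q : ℝ) - r : ℝ) : UnitAddCircle)‖ ≤ |(q : ℝ) - r| := by
    rw [← Real.norm_eq_abs]
    exact QuotientAddGroup.norm_mk_le_norm
  refine h.trans ?_
  rw [abs_of_pos (by linarith)]
  linarith

/-- Finitely many values of a function into the circle are approximated by some target. -/
theorem ApproxTask.exists_target_approx {ι : Type u} (F : Finset (Bool × Set ι))
    (y : Bool × Set ι → UnitAddCircle) {ε : ℝ} (hε : 0 < ε) :
    ∃ r : ApproxTask ι, 1 / ((r.2.2 : ℝ) + 1) ≤ ε ∧ ∀ i ∈ F, ‖r.target i - y i‖ ≤ ε := by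
  classical
  obtain ⟨n, hn⟩ := exists_nat_one_div_lt hε
  obtain ⟨A, hA⟩ := exists_injOn_setTrace (F.image Prod.snd)
  choose q hq using fun i => UnitAddCircle.exists_rat_norm_sub_le (y i) hε
  let tr : Bool × Set ι → Bool × Finset ι := fun i => (i.1, setTrace A i.2)
  have htr : ∀ i ∈ F, ∀ j ∈ F, tr i = tr j → i = j := fun i hi j hj h => by
    obtain ⟨h1, h2⟩ := Prod.ext_iff.1 h
    exact Prod.ext h1 (hA (Finset.mem_coe.2 (Finset.mem_image_of_mem _ hi))
      (Finset.mem_coe.2 (Finset.mem_image_of_mem _ hj)) h2)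
  refine ⟨(A, ∑ i ∈ F, Finsupp.single (tr i) (q i), n), hn.le, fun i hi => ?_⟩
  have : (∑ j ∈ F, Finsupp.single (tr j) (q j)) (tr i) = q i := by
    rw [Finsupp.finsetSum_apply, Finset.sum_eq_single_of_mem i hi]
    · simp
    · intro j hj hji
      rw [Finsupp.single_apply, if_neg fun h => hji (htr j hj i hi h)]
  have h2 : ApproxTask.target (A, ∑ i ∈ F, Finsupp.single (tr i) (q i), n) i =
      ((q i : ℝ) : UnitAddCircle) := by
    simp only [ApproxTask.target]
    rw [← this]
  rw [h2]
  exact hq i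

theorem ApproxTask.mk_le (ι : Type u) [Infinite ι] : #(ApproxTask ι) ≤ #ι := by
  have h := aleph0_le_mk ι
  have h1 : #(Bool × Finset ι →₀ ℚ) = #ι := by
    have : (2 : Cardinal) * #ι = #ι := mul_eq_right h (ofNat_lt_aleph0.le.trans h) two_ne_zero
    simp [this, h]
  have h2 : #(ApproxTask ι) = #ι * (#ι * ℵ₀) := by
    simp only [ApproxTask, mk_prod, lift_id, lift_uzero, h1, mk_finset_of_infinite, mk_nat,
      lift_aleph0]
  rw [h2, mul_aleph0_eq h, mul_eq_self h]

/-- On an initial order type, every element of a set that is not larger can be listed cofinally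
often. -/
theorem exists_cofinal_listing {ι R : Type u} [LinearOrder ι] [Infinite ι]
    (hinit : ∀ s : ι, #(Set.Iio s) < #ι) (hR : #R ≤ #ι) [Nonempty R] :
    ∃ req : ι → R, ∀ r t, ∃ s, t < s ∧ req s = r := by
  have : Nonempty ι := inferInstance
  obtain ⟨⟨i, hi⟩⟩ : #(R × ι) ≤ #ι := by
    rw [mk_prod, lift_id, lift_id]
    exact (mul_le_mul_left hR _).trans (mul_eq_self (aleph0_le_mk ι)).le
  have hq := Function.invFun_surjective hi
  refine ⟨fun s => (Function.invFun i s).1, fun r t => ?_⟩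
  by_contra! h
  have hinj : #ι ≤ #(Set.Iic t) := by
    refine mk_le_of_injective (f := fun x => ⟨i (r, x), ?_⟩) fun x x' hx => ?_
    · by_contra hlt
      exact h (i (r, x)) (not_le.1 hlt) (by rw [Function.leftInverse_invFun hi])
    · simpa using hi (Subtype.ext_iff.1 hx)
  refine hinj.not_gt ?_
  rw [← Set.Iio_insert]
  refine mk_insert_le.trans_lt (add_lt_of_lt (aleph0_le_mk ι) (hinit t) ?_)
  exact one_lt_aleph0.trans_le (aleph0_le_mk ι)

/-- Characters indexed by `Bool × Set ι`, where `ι` is a well-order of type `κ`, at which finitely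
many values can be prescribed by a suitable element of `S`. Those with first index `false` separate
a given family of `κ` points from `0`. -/
theorem exists_characters_generic {G ι : Type u} [AddCommGroup G] {κ : Cardinal.{u}}
    (hκ : ℵ₀ ≤ κ) {S : Set G} (hS : ∀ n : ℕ, 1 ≤ n → κ ≤ #(multSet n S))
    [LinearOrder ι] [WellFoundedLT ι] (hι : #ι = κ) (hinit : ∀ s : ι, #(Set.Iio s) < κ)
    (h : ι → G) :
    ∃ χ : Bool × Set ι → (G →+ UnitAddCircle),
      (∀ t, h t ≠ 0 → ∃ i, χ (false, i) (h t) ≠ 0) ∧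
      ∀ (F : Finset (Bool × Set ι)) (y : Bool × Set ι → UnitAddCircle) (ε : ℝ), 0 < ε →
        ∃ s ∈ S, ∀ i ∈ F, ‖χ i s - y i‖ ≤ ε := by
  have : Infinite ι := infinite_iff.2 (hι ▸ hκ)
  obtain ⟨req, hreq⟩ := exists_cofinal_listing (R := ApproxTask ι) (fun s => hι ▸ hinit s)
    (ApproxTask.mk_le ι)
  obtain ⟨e, heS, he⟩ := exists_interpolation_points hκ hS hι hinit
    (ε := fun s => 1 / (((req s).2.2 : ℝ) + 1)) (fun s => by positivity) h
  -- The character with index `(b, {t})` is responsible for the point `h t`; it may fail to solve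
  -- the problems with index up to `t`, but each problem occurs again beyond `t`.
  let τ : Bool × Set ι → ι := fun i => Function.invFun (fun t : ι => ({t} : Set ι)) i.2
  choose χ hχ0 hχ using fun i : Bool × Set ι => he (fun s => (req s).target i) (τ i)
  refine ⟨χ, fun t ht => ⟨{t}, ?_⟩, fun F y ε hε => ?_⟩
  · have hτ : τ (false, {t}) = t :=
      Function.leftInverse_invFun (Set.singleton_injective (α := ι)) t
    have := hχ0 (false, {t})
    rw [hτ] at this
    exact this ht
  · obtain ⟨r, hr, hrF⟩ := ApproxTask.exists_target_approx F y (half_pos hε)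
    obtain ⟨t, ht⟩ := (F.image τ).exists_le
    obtain ⟨s, hs, rfl⟩ := hreq r t
    refine ⟨e s, heS s, fun i hi => ?_⟩
    have h1 := hχ i s ((ht _ (Finset.mem_image_of_mem _ hi)).trans_lt hs)
    calc ‖χ i (e s) - y i‖ = ‖(χ i (e s) - (req s).target i) + ((req s).target i - y i)‖ := by
          rw [sub_add_sub_cancel]
      _ ≤ ‖χ i (e s) - (req s).target i‖ + ‖(req s).target i - y i‖ := norm_add_le _ _
      _ ≤ ε / 2 + ε / 2 := add_le_add (h1.trans hr) (hrF i hi)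
      _ = ε := add_halves ε

/-! ### Dense embeddings into powers of the circle -/

/-- If each `n • S` with `n ≥ 1` has at least `#ι` elements, then so does each `n • X` for some
`X ⊆ S` that is indexed by `ℕ × ι`, hence has no more than `#ι` elements when `ι` is infinite. -/
theorem exists_range_subset_le_mk_multSet {G ι : Type u} [AddCommGroup G] {S : Set G}
    (hS : ∀ n : ℕ, 1 ≤ n → #ι ≤ #(multSet n S)) :
    ∃ a : ℕ × ι → G, Set.range a ⊆ S ∧ ∀ n : ℕ, 1 ≤ n → #ι ≤ #(multSet n (Set.range a)) := by
  have h : ∀ n : ℕ, ∃ a : ι → G, (∀ x, a x ∈ S) ∧ Function.Injective fun x => (n + 1) • a x :=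
    fun n => by
      obtain ⟨⟨i, hi⟩⟩ := hS (n + 1) n.succ_pos
      choose a ha hai using fun x => (i x).2
      exact ⟨a, ha, fun x x' hx => hi (Subtype.ext ((hai x).symm.trans (hx.trans (hai x'))))⟩
  choose a haS ha using h
  refine ⟨fun p => a p.1 p.2, Set.range_subset_iff.2 fun p => haS _ _, fun n hn => ?_⟩
  obtain ⟨m, rfl⟩ := Nat.exists_eq_add_of_le' hn
  exact mk_le_of_injective (f := fun x => ⟨(m + 1) • a m x, a m x, ⟨(m, x), rfl⟩, rfl⟩)
    fun x x' hx => ha m (Subtype.ext_iff.1 hx)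

/-- A homomorphism that is injective on `H` becomes injective on `G` together with a second one,
which may be prescribed on `H` and restricts to an embedding of the kernel of the first. -/
theorem exists_hom_eqOn_injective_prod {G K J : Type*} [AddCommGroup G] [AddCommGroup K]
    (H : AddSubgroup G) (f₀ : G →+ K) (hf₀ : ∀ x ∈ H, f₀ x = 0 → x = 0)
    (f₁ : G →+ (J → UnitAddCircle)) (j : f₀.ker →+ (J → UnitAddCircle))
    (hj : Function.Injective j) :
    ∃ g : G →+ (J → UnitAddCircle), (∀ x ∈ H, g x = f₁ x) ∧ ∀ x, f₀ x = 0 → g x = 0 → x = 0 := by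
  obtain ⟨g, hg⟩ := AddMonoidHom.exists_comp_eq_of_ker_le_pi (H.subtype.coprod f₀.ker.subtype)
    ((f₁.comp H.subtype).coprod j) (by
      rintro ⟨x, n⟩ h
      have h' : (x : G) + n = 0 := h
      have hn : f₀ n = 0 := n.2
      have hx : x = 0 := Subtype.ext (hf₀ x x.2 (by
        have := congrArg f₀ h'
        simpa [hn] using this))
      have hn' : n = 0 := Subtype.ext (by simpa [hx] using h')
      simp [hx, hn'])
  refine ⟨g, fun x hx => by simpa using hg (⟨x, hx⟩, 0), fun x hx h0 => ?_⟩
  have h1 : g x = j ⟨x, hx⟩ := by simpa using hg (0, ⟨x, hx⟩)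
  exact congrArg Subtype.val ((injective_iff_map_eq_zero j).1 hj _ (h1.symm.trans h0))

/-- If `G` has at most `2 ^ 2 ^ κ` elements and every `n • S` has at least `κ` elements, then `G`
embeds into a power of the circle in such a way that the image of `S` is dense. -/
theorem exists_injective_hom_pi_dense_image {G : Type u} [AddCommGroup G] {κ : Cardinal.{u}}
    (hκ : ℵ₀ ≤ κ) (hG : #G ≤ 2 ^ (2 ^ κ : Cardinal.{u})) {S : Set G}
    (hS : ∀ n : ℕ, 1 ≤ n → κ ≤ #(multSet n S)) :
    ∃ (I : Type u) (f : G →+ (I → UnitAddCircle)), Function.Injective f ∧ Dense (f '' S) := by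
  let ι := κ.ord.ToType
  have hι : #ι = κ := mk_ord_toType κ
  have : Infinite ι := infinite_iff.2 (hι ▸ hκ)
  have hinit : ∀ s : ι, #(Set.Iio s) < κ := fun s => by
    conv_rhs => rw [← hι]
    exact mk_Iio_lt s (by rw [hι, Ordinal.type_toType])
  obtain ⟨a, haS, ha⟩ := exists_range_subset_le_mk_multSet (ι := ι) (S := S)
    (fun n hn => hι ▸ hS n hn)
  let H := Submodule.span ℤ (Set.range a)
  have hH : #H ≤ #ι := (mk_span_range_le a).trans (by
    simp [hι, hκ, mul_comm ℵ₀, mul_aleph0_eq])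
  obtain ⟨⟨i, hi⟩⟩ := hH
  obtain ⟨q, hq⟩ : ∃ q : ι → H, Function.Surjective q := ⟨_, Function.invFun_surjective hi⟩
  obtain ⟨χ, hχ0, hχ⟩ := exists_characters_generic hκ (fun n hn => hι ▸ ha n hn) hι hinit
    (fun t => (q t : G))
  let f₀ : G →+ (Set ι → UnitAddCircle) := AddMonoidHom.pi fun i => χ (false, i)
  let f₁ : G →+ (Set ι → UnitAddCircle) := AddMonoidHom.pi fun i => χ (true, i)
  obtain ⟨j, hj⟩ := exists_injective_hom_pi_unitAddCircle (N := f₀.ker) (J := Set ι) (by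
    rw [mk_set, hι]
    exact (mk_subtype_le _).trans hG)
  obtain ⟨g, hgH, hg⟩ := exists_hom_eqOn_injective_prod H.toAddSubgroup f₀ (fun x hx h0 => by
    by_contra hne
    obtain ⟨t, ht⟩ := hq ⟨x, hx⟩
    obtain ⟨i, hi⟩ := hχ0 t (by rwa [ht])
    rw [ht] at hi
    exact hi (congrFun h0 i)) f₁ j hj
  let f : G →+ (Bool × Set ι → UnitAddCircle) :=
    AddMonoidHom.pi fun i => if i.1 then (Pi.evalAddMonoidHom _ i.2).comp g else χ (false, i.2)
  have hf : ∀ x ∈ H, ∀ i, f x i = χ i x := by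
    rintro x hx ⟨_ | _, i⟩
    · simp [f]
    · simpa [f, f₁] using congrFun (hgH x hx) i
  refine ⟨Bool × Set ι, f, (injective_iff_map_eq_zero f).2 fun x hx => ?_, fun y => ?_⟩
  · refine hg x (funext fun i => ?_) (funext fun i => ?_)
    · simpa [f, f₀] using congrFun hx (false, i)
    · simpa [f] using congrFun hx (true, i)
  · rw [mem_closure_iff_nhds]
    intro U hU
    rw [nhds_pi, Filter.mem_pi] at hU
    obtain ⟨F, hF, V, hV, hVU⟩ := hU
    choose ε hε hεV using fun i => Metric.nhds_basis_closedBall.mem_iff.1 (hV i)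
    obtain ⟨δ, hδ, hδε⟩ : ∃ δ : ℝ, 0 < δ ∧ ∀ i ∈ F, δ ≤ ε i := by
      rcases F.eq_empty_or_nonempty with rfl | hne
      · exact ⟨1, one_pos, by simp⟩
      · obtain ⟨i, hi, hmin⟩ := Set.exists_min_image F ε hF hne
        exact ⟨ε i, hε i, hmin⟩
    obtain ⟨s, hs, hsF⟩ := hχ hF.toFinset y δ hδ
    refine ⟨f s, hVU fun i hi => hεV i ?_, s, haS hs, rfl⟩
    rw [Metric.mem_closedBall, dist_eq_norm, hf s (Submodule.subset_span hs)]
    exact (hsF i (hF.mem_toFinset.2 hi)).trans (hδε i hi)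

/-! ### Cardinality of Hausdorff groups with a given dense set -/

theorem cardLog_spec (κ : Cardinal.{u}) : ℵ₀ ≤ cardLog κ ∧ κ ≤ 2 ^ cardLog κ :=
  csInf_mem (s := {τ : Cardinal.{u} | ℵ₀ ≤ τ ∧ κ ≤ 2 ^ τ})
    ⟨max ℵ₀ κ, le_max_left _ _, (le_max_right _ _).trans (cantor _).le⟩

theorem cardLog_le {κ τ : Cardinal.{u}} (hτ : ℵ₀ ≤ τ) (h : κ ≤ 2 ^ τ) : cardLog κ ≤ τ :=
  csInf_le' ⟨hτ, h⟩

/-- In a Hausdorff space a point of the closure of `D` is determined by the traces of its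
neighbourhoods on `D`. -/
theorem mk_le_of_subset_closure {X : Type u} [TopologicalSpace X] [T2Space X] {C D : Set X}
    (h : C ⊆ closure D) : #C ≤ 2 ^ (2 ^ #D : Cardinal.{u}) := by
  rw [← mk_set, ← mk_set]
  refine mk_le_of_injective
    (f := fun x : C => {W : Set D | ∃ U ∈ nhds (x : X), W = Subtype.val ⁻¹' U}) fun x y hxy => ?_
  by_contra hne
  obtain ⟨U, V, hU, hV, hUV⟩ := t2_separation_nhds fun h => hne (Subtype.ext h)
  obtain ⟨V', hV', hUV'⟩ : (Subtype.val ⁻¹' U : Set D) ∈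
      {W : Set D | ∃ V ∈ nhds (y : X), W = Subtype.val ⁻¹' V} :=
    hxy.subset ⟨U, hU, rfl⟩
  obtain ⟨d, ⟨hdV, hdV'⟩, hd⟩ :=
    mem_closure_iff_nhds.1 (h y.2) _ (Filter.inter_mem hV hV')
  have hdU : d ∈ U := (hUV'.superset hdV' : (⟨d, hd⟩ : D) ∈ Subtype.val ⁻¹' U)
  exact Set.disjoint_left.1 hUV hdU hdV

theorem mk_multSet_univ_le_of_isPotentiallyDense {G : Type u} [AddCommGroup G] {S : Set G}
    (hS : IsPotentiallyDense S) (n : ℕ) :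
    #(multSet n (Set.univ : Set G)) ≤ 2 ^ (2 ^ #(multSet n S) : Cardinal.{u}) := by
  obtain ⟨_, _, _, hd⟩ := hS
  refine mk_le_of_subset_closure ?_
  rw [← hd.closure_eq]
  exact image_closure_subset_closure_image (continuous_nsmul n)

/-! ### Multiples of the whole group -/

/-- If the `n`-torsion of an infinite group `G` is smaller than `G`, then `nG` is as large as `G`,
being isomorphic to the quotient of `G` by its `n`-torsion. -/
theorem mk_multSet_univ_eq_of_mk_ker_lt {G : Type u} [AddCommGroup G] [Infinite G] {n : ℕ}
    (h : #(nsmulAddMonoidHom (α := G) n).ker < #G) : #(multSet n (Set.univ : Set G)) = #G := by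
  set φ := nsmulAddMonoidHom (α := G) n
  have h1 : #G = #(multSet n (Set.univ : Set G)) * #φ.ker := by
    have e : multSet n (Set.univ : Set G) = Set.range φ := Set.image_univ
    rw [e, mk_congr AddSubgroup.addGroupEquivQuotientProdAddSubgroup (α := G), mk_prod, lift_id,
      lift_id, mk_congr (QuotientAddGroup.quotientKerEquivRange φ).toEquiv]
    rfl
  refine le_antisymm (mk_set_le _) ?_
  by_contra! hlt
  exact (mul_lt_of_lt (aleph0_le_mk G) hlt h).ne h1.symm

/-- A group with finite `p`-ranks has finite `n`-torsion for every `n ≥ 1`. -/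
theorem IsAlmostTorsionFree.finite_ker_nsmul {G : Type u} [AddCommGroup G]
    (hG : IsAlmostTorsionFree G) {n : ℕ} (hn : n ≠ 0) :
    {x : G | n • x = 0}.Finite := by
  induction n using Nat.recOnMul with
  | zero => exact (hn rfl).elim
  | one => simp
  | prime p hp =>
    have : Fact p.Prime := ⟨hp⟩
    let _ : Module (ZMod p) (AddSubgroup.torsionBy G (p : ℤ)) := AddSubgroup.torsionBy.zmodModule
    have : Module.Finite (ZMod p) (AddSubgroup.torsionBy G (p : ℤ)) :=
      Module.rank_lt_aleph0_iff.1 (hG p hp)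
    have : Finite (AddSubgroup.torsionBy G (p : ℤ)) := Module.finite_of_finite (ZMod p)
    refine (Set.toFinite (AddSubgroup.torsionBy G (p : ℤ) : Set G)).subset fun x hx => ?_
    change (p : ℤ) • x = 0
    simpa using hx
  | mul a b iha ihb =>
    have ha := iha (left_ne_zero_of_mul hn)
    have hb := ihb (right_ne_zero_of_mul hn)
    -- Multiplication by `b` maps the `a * b`-torsion to the `a`-torsion, with fibres that are
    -- cosets of the `b`-torsion.
    refine Set.Finite.of_finite_fibers (fun x => b • x) (ha.subset ?_) fun y _ => ?_
    · rintro _ ⟨x, hx, rfl⟩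
      simpa [mul_smul] using hx
    · rcases Set.eq_empty_or_nonempty ({x : G | (a * b) • x = 0} ∩ (fun x => b • x) ⁻¹' {y})
        with h | ⟨x₀, -, hx₀⟩
      · rw [h]; exact Set.finite_empty
      · refine (hb.image fun x => x + x₀).subset ?_
        rintro x ⟨-, hx⟩
        refine ⟨x - x₀, ?_, by simp⟩
        have h1 : b • x = y := hx
        have h2 : b • x₀ = y := hx₀
        simp [smul_sub, h1, h2]

theorem IsAlmostTorsionFree.mk_torsion_le {G : Type u} [AddCommGroup G]
    (hG : IsAlmostTorsionFree G) : #(AddCommGroup.torsion G) ≤ ℵ₀ := by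
  have h : (⋃ n : ℕ, {x : G | (n + 1) • x = 0}).Countable :=
    Set.countable_iUnion fun n => (hG.finite_ker_nsmul n.succ_ne_zero).countable
  refine Cardinal.le_aleph0_iff_set_countable.2 (h.mono fun x hx => ?_)
  obtain ⟨n, hn, hx⟩ := isOfFinAddOrder_iff_nsmul_eq_zero.1 hx
  exact Set.mem_iUnion.2 ⟨n - 1, by rwa [Set.mem_ofPred_eq, Nat.sub_add_cancel hn]⟩

/-- If `G` is uncountable and divisible, or if its torsion part is small in one of the three senses
listed, then `nG` is as large as `G`. -/
theorem mk_multSet_univ_eq {G : Type u} [AddCommGroup G]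
    (hG : IsDivisibleGroup G ∨ #(AddCommGroup.torsion G) < #G ∨
      #(AddCommGroup.torsion G) ≤ ℵ₀ ∨ IsAlmostTorsionFree G)
    (hunc : ℵ₀ < #G) {n : ℕ} (hn : 1 ≤ n) : #(multSet n (Set.univ : Set G)) = #G := by
  have : Infinite G := infinite_iff.2 hunc.le
  have key : #(AddCommGroup.torsion G) < #G → #(multSet n (Set.univ : Set G)) = #G := fun h =>
    mk_multSet_univ_eq_of_mk_ker_lt ((mk_le_mk_of_subset fun x hx =>
      isOfFinAddOrder_iff_nsmul_eq_zero.2 ⟨n, hn, hx⟩).trans_lt h)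
  rcases hG with h | h | h | h
  · rw [h n hn, mk_univ]
  · exact key h
  · exact key (h.trans_lt hunc)
  · exact key (h.mk_torsion_le.trans_lt hunc)

/-! ### Equivalence of the density conditions -/

/-- The topology induced by an embedding into a power of the circle is precompact. -/
theorem exists_isPrecompactGroup_dense {G : Type u} [AddCommGroup G] {S : Set G} {I : Type u}
    (f : G →+ (I → UnitAddCircle)) (hf : Function.Injective f) (hS : Dense (f '' S)) :
    ∃ _ : TopologicalSpace G, IsPrecompactGroup G ∧ T2Space G ∧ Dense S := by
  let τ : TopologicalSpace G := TopologicalSpace.induced f inferInstance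
  have hind : Topology.IsInducing f := ⟨rfl⟩
  have hemb : Topology.IsEmbedding f := ⟨hind, hf⟩
  have hgrp : IsTopologicalAddGroup G := topologicalAddGroup_induced f
  refine ⟨τ, ⟨hgrp, I → UnitAddCircle, inferInstance, inferInstance, inferInstance, inferInstance,
    inferInstance, f.range, ⟨?_⟩⟩, hemb.t2Space, fun x => ?_⟩
  · exact
      { AddMonoidHom.ofInjective hf with
        continuous_toFun := hemb.toHomeomorph.continuous
        continuous_invFun := by
          refine hind.continuous_iff.2 ?_
          refine continuous_subtype_val.congr fun y => ?_
          exact congrArg Subtype.val ((AddMonoidHom.ofInjective hf).apply_symm_apply y).symm }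
  · rw [hind.closure_eq_preimage_closure_image]
    exact hS (f x)

theorem mainTheorem3 (G : Type u) [AddCommGroup G]
    (hG : IsDivisibleGroup G ∨
      #(AddCommGroup.torsion G) < #G ∨
      #(AddCommGroup.torsion G) ≤ ℵ₀ ∨
      IsAlmostTorsionFree G)
    (S : Set G) (hS : ¬ S.Countable) :
    List.TFAE [
      IsPotentiallyDense S,
      ∃ _ : TopologicalSpace G, IsPrecompactGroup G ∧ T2Space G ∧ Dense S,
      ∀ n : ℕ, 1 ≤ n →
        cardLog (cardLog #(multSet n (Set.univ : Set G))) ≤ #(multSet n S),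
      cardLog (cardLog #G) ≤ ⨅ n : {n : ℕ // 1 ≤ n}, #(multSet n.1 S)] := by
  have hunc : ℵ₀ < #G := by
    rw [← not_le]
    exact fun h => hS ((Set.countable_univ_iff.2 (mk_le_aleph0_iff.1 h)).mono (Set.subset_univ S))
  tfae_have 2 → 1 := by
    rintro ⟨τ, hτ, h2, hd⟩
    exact ⟨τ, hτ.1, h2, hd⟩
  tfae_have 1 → 3 := by
    intro h n hn
    have hle := mk_multSet_univ_le_of_isPotentiallyDense h n
    have hinf : ℵ₀ ≤ #(multSet n S) := by
      -- A finite dense set would make the infinite group `nG` finite.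
      by_contra! hlt
      rw [mk_multSet_univ_eq hG hunc hn] at hle
      exact (hunc.trans_le hle).not_gt
        (power_lt_aleph0 ofNat_lt_aleph0 (power_lt_aleph0 ofNat_lt_aleph0 hlt))
    exact cardLog_le hinf (cardLog_le (hinf.trans (cantor _).le) hle)
  tfae_have 3 → 4 := by
    intro h
    have : Nonempty {n : ℕ // 1 ≤ n} := ⟨⟨1, le_rfl⟩⟩
    refine le_ciInf fun n => ?_
    rw [← mk_multSet_univ_eq hG hunc n.2]
    exact h n n.2
  tfae_have 4 → 2 := by
    intro h
    have hlog := cardLog_spec (cardLog #G)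
    obtain ⟨I, f, hf, hd⟩ := exists_injective_hom_pi_dense_image (S := S) hlog.1
      ((cardLog_spec #G).2.trans (power_le_power_left two_ne_zero hlog.2))
      (fun n hn => h.trans (ciInf_le' _ (⟨n, hn⟩ : {n : ℕ // 1 ≤ n})))
    exact exists_isPrecompactGroup_dense f hf hd
  tfae_finish
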